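/- There exists an absolute constant $c>0$ with the following property. Let $(\omega_n)_{n\ge 0}$ be any sequence of complex numbers with $|\omega_n|=1$ for all $n\ge 0$, let \[ F(z)=\sum_{n\ge 0}\omega_n\,\frac{z^n}{n!},\qquad z\in\mathbb C, \] and let $n_F(R)$ denote the number of zeros of $F$ in the closed disk $\{|z|\le R\}$, counted with multiplicities. Then either $F$ is an exponential function, that is, $F(z)=\Theta e^{\alpha z}$ for all $z\in\mathbb C$ with some $\Theta,\alpha\in\mathbb C$, $|\Theta|=|\alpha|=1$, or \[ \liminf_{R\to\infty}\frac{n_F(R)}{R}\ge c . \] -/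

import Mathlib

open Filter

/-- The number of zeros of `F` in the closed disk `{z | ‖z‖ ≤ R}`, counted with multiplicities
(for an entire function `F` that is not identically zero, only finitely many terms are nonzero). -/
noncomputable def zeroCount (F : ℂ → ℂ) (R : ℝ) : ℕ :=
  ∑ᶠ z ∈ Metric.closedBall (0 : ℂ) R, analyticOrderNatAt F z

/-! Suppose zeros are scarce along a sequence of radii R → ∞, and let T be a small fixed fraction of
R. Replacing the linear factors of the zeros by Blaschke denominators gives a zero-free H with |F| ≤
|H| ≤ e^R, whose logarithm is linear up to a quadratic error by Borel–Carathéodory. Hence |F(z)| ≤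
exp(Re(az) + T) for |z| ≤ 1000T (`exists_norm_le_exp_of_zeroCount_le`).

The Taylor coefficients of F·e^{-az} are then small enough for a truncated Newton series to give an
entire Q with Q(n) = ω_n/a^n for n < 100T and |Q| ≤ 2e^T on |z| ≤ 100T. Unimodularity now enters:
|Q(n)| = |a|^{-n}, so with l = log|a| the function Q(z)·conj(Q(conj z))·e^{lz} − e^{−lz} vanishes at
all these n. It is therefore smaller than e^{-T} on |z| ≤ T, which forbids zeros of Q there
(`ne_zero_of_norm_natCast_eq_exp`).

So log Q is nearly linear too, and ω_{n+2}ω_n/ω_{n+1}² = exp(O((n+2)²/T)). Letting T → ∞ with n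
fixed makes ω geometric and F exponential. -/

/-! ### Logarithms of zero-free functions -/

/-- A bounded zero-free holomorphic function on a disk is an exponential of a linear function up to
a quadratic error in the exponent. -/
theorem exists_linear_exponent {H : ℂ → ℂ} {A R : ℝ} (hR : 0 < R) (hA : 0 < A)
    (hH : DifferentiableOn ℂ H (Metric.ball 0 R)) (hne : ∀ z ∈ Metric.ball (0 : ℂ) R, H z ≠ 0)
    (hb : ∀ z ∈ Metric.ball (0 : ℂ) R, ‖H z‖ ≤ Real.exp A) (h1 : 1 ≤ ‖H 0‖) :
    ∃ a : ℂ, ‖a‖ ≤ 2 * A / R ∧ ∀ z : ℂ, ‖z‖ < R / 2 →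
      ∃ w : ℂ, H z = H 0 * Complex.exp (a * z + w) ∧ ‖w‖ ≤ 12 * A * (‖z‖ / R) ^ 2 := by
  have h0mem : (0 : ℂ) ∈ Metric.ball (0 : ℂ) R := by simpa using hR
  have hL : DifferentiableOn ℂ (fun z => deriv H z / H z) (Metric.ball 0 R) :=
    (hH.deriv Metric.isOpen_ball).div hH hne
  obtain ⟨h, hh0, hh⟩ := hL.isExactOn_ball.with_val_at 0 0
  have hexp : ∀ z ∈ Metric.ball (0 : ℂ) R, H z = H 0 * Complex.exp (h z) := by
    have hder : ∀ z ∈ Metric.ball (0 : ℂ) R,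
        HasDerivAt (fun z => H z * Complex.exp (-h z)) 0 z := by
      intro z hz
      have h2 := (hH.differentiableAt (Metric.isOpen_ball.mem_nhds hz)).hasDerivAt.mul
        (hh z hz).fun_neg.cexp
      rw [show deriv H z * Complex.exp (-h z) + H z * (Complex.exp (-h z) * -(deriv H z / H z)) =
        0 by rw [mul_left_comm, mul_neg, mul_div_cancel₀ _ (hne z hz)]; ring] at h2
      exact h2
    intro z hz
    have := Metric.isOpen_ball.is_const_of_deriv_eq_zero (convex_ball (0 : ℂ) R).isPreconnected
      (fun z hz => (hder z hz).differentiableAt.differentiableWithinAt)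
      (fun z hz => (hder z hz).deriv) hz h0mem
    simp only [hh0, neg_zero, Complex.exp_zero, mul_one] at this
    rw [← this, mul_assoc, ← Complex.exp_add]
    simp
  have hdiff : DifferentiableOn ℂ h (Metric.ball 0 R) :=
    fun z hz => (hh z hz).differentiableAt.differentiableWithinAt
  have hre : Set.MapsTo h (Metric.ball 0 R) {z | z.re ≤ A} := by
    intro z hz
    have h2 := hb z hz
    rw [hexp z hz, norm_mul, Complex.norm_exp] at h2
    have h3 : Real.exp (h z).re ≤ Real.exp A :=
      le_trans (le_mul_of_one_le_left (Real.exp_pos _).le h1) h2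
    exact Real.exp_le_exp.1 h3
  have hbc : ∀ z ∈ Metric.ball (0 : ℂ) R, ‖h z‖ ≤ 2 * A * ‖z‖ / (R - ‖z‖) :=
    fun z hz => Complex.borelCaratheodory_zero hA hdiff hre hR hz hh0
  set a := deriv H 0 / H 0 with ha
  have hda : HasDerivAt h a 0 := hh 0 h0mem
  have hnorm : ‖a‖ ≤ 2 * A / R := by
    have t1 := (hasDerivAt_iff_tendsto_slope_zero.1 hda).norm
    have t2 : Tendsto (fun t : ℂ => 2 * A / (R - ‖t‖)) (nhdsWithin 0 {0}ᶜ)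
        (nhds (2 * A / (R - ‖(0 : ℂ)‖))) := by
      apply Tendsto.mono_left _ nhdsWithin_le_nhds
      apply ContinuousAt.tendsto
      apply ContinuousAt.div (by fun_prop) (by fun_prop)
      simpa using hR.ne'
    simp only [norm_zero, sub_zero] at t2
    -- Divide the Borel–Carathéodory bound by ‖t‖ and let t → 0.
    refine le_of_tendsto_of_tendsto t1 t2 ?_
    filter_upwards [self_mem_nhdsWithin,
      mem_nhdsWithin_of_mem_nhds (Metric.isOpen_ball.mem_nhds h0mem)] with t ht htR
    have ht' : 0 < ‖t‖ := norm_pos_iff.2 ht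
    have := hbc t htR
    simp only [zero_add, hh0, sub_zero, norm_smul, norm_inv]
    rw [inv_mul_le_iff₀ ht']
    exact this.trans_eq (by ring)
  refine ⟨a, hnorm, fun z hz => ⟨h z - a * z, ?_, ?_⟩⟩
  · rw [hexp z (by simp; linarith)]
    congr 2
    ring
  · set k : ℂ → ℂ := fun z => h z - a * z with hk
    have hk0 : k 0 = 0 := by simp [hk, hh0]
    have hsub : Metric.ball (0 : ℂ) (R / 2) ⊆ Metric.ball 0 R :=
      Metric.ball_subset_ball (by linarith)
    have hmaps : Set.MapsTo k (Metric.ball 0 (R / 2)) (Metric.closedBall (k 0) (3 * A)) := by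
      intro x hx
      have hx2 : ‖x‖ < R / 2 := by simpa using hx
      rw [hk0, mem_closedBall_zero_iff]
      have e1 : ‖h x‖ ≤ 2 * A := by
        refine (hbc x (hsub hx)).trans ?_
        rw [div_le_iff₀ (by linarith)]
        nlinarith
      have e2 : ‖a * x‖ ≤ A := by
        rw [norm_mul]
        calc ‖a‖ * ‖x‖ ≤ 2 * A / R * (R / 2) := by gcongr
          _ = A := by field_simp
      exact (norm_sub_le _ _).trans (by linarith)
    have hlo : (k · - k 0) =o[nhds 0] (fun w : ℂ => ‖w - 0‖ ^ 1) := by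
      have := hda.isLittleO
      simp only [pow_one]
      refine (this.norm_right).congr_left fun x => ?_
      simp [hk, hh0, mul_comm]
    -- Second-order Schwarz lemma: k vanishes to order two and is at most 3A on the half disk,
    -- whence 3A(2‖z‖/R)².
    have := Complex.dist_le_mul_div_pow_of_mapsTo_ball_of_isLittleO (c := 0)
      (show DifferentiableOn ℂ k _ from (hdiff.mono hsub).sub (by fun_prop)) hmaps hlo
      (by simpa using hz)
    rw [hk0, dist_zero_right, dist_zero_right] at this
    refine this.trans_eq ?_
    rw [show ‖z‖ / (R / 2) = 2 * (‖z‖ / R) by field_simp]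
    ring

/-! ### Blaschke products and zero counting -/

theorem norm_prod_map (s : Multiset ℂ) (f : ℂ → ℂ) :
    ‖(s.map f).prod‖ = (s.map fun w => ‖f w‖).prod := by
  induction s using Multiset.induction_on with
  | empty => simp
  | cons a s ih => simp [ih]

/-- Dividing out zeros by a Blaschke product does not increase the maximum modulus. -/
theorem norm_mul_prod_le_of_forall_norm_eq {g : ℂ → ℂ} (hg : Differentiable ℂ g)
    (s : Multiset ℂ) {R A : ℝ} (hR : 0 < R)
    (hb : ∀ z : ℂ, ‖z‖ = R → ‖(s.map fun w => z - w).prod * g z‖ ≤ A)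
    {z : ℂ} (hz : ‖z‖ ≤ R) :
    ‖(s.map fun w => (R : ℂ) - (starRingEnd ℂ) w * z / R).prod * g z‖ ≤ A := by
  have hd : Differentiable ℂ fun z =>
      (s.map fun w => (R : ℂ) - (starRingEnd ℂ) w * z / R).prod * g z := by
    apply Differentiable.mul _ hg
    clear hb
    induction s using Multiset.induction_on with
    | empty => simp
    | cons a s ih => simp only [Multiset.map_cons, Multiset.prod_cons]; fun_prop
  refine Complex.norm_le_of_forall_mem_frontier_norm_le (Metric.isBounded_ball (x := (0 : ℂ)) (r := R))
    hd.diffContOnCl (C := A) ?_ ?_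
  · intro x hx
    rw [frontier_ball _ hR.ne', mem_sphere_zero_iff_norm] at hx
    convert hb x hx using 1
    rw [norm_mul, norm_mul, norm_prod_map, norm_prod_map]
    congr 3
    ext w
    have hR' : (R : ℂ) ≠ 0 := by exact_mod_cast hR.ne'
    -- On the circle ‖x‖ = R this gives the denominator the same modulus as x - w, so the maximum
    -- principle applies.
    have e : (R : ℂ) - (starRingEnd ℂ) w * x / R = x * (starRingEnd ℂ) (x - w) / R := by
      have e2 : x * (starRingEnd ℂ) x = (R : ℂ) ^ 2 := by rw [Complex.mul_conj', hx]
      field_simp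
      rw [map_sub, mul_sub, e2]
      ring
    rw [e, norm_div, norm_mul, Complex.norm_conj, hx, Complex.norm_real, Real.norm_eq_abs,
      abs_of_pos hR]
    field_simp
  · rw [closure_ball _ hR.ne']
    simpa using hz

theorem exists_eq_sub_mul_of_eq_zero {F : ℂ → ℂ} (hF : Differentiable ℂ F) {w : ℂ}
    (hw : F w = 0) : ∃ G : ℂ → ℂ, Differentiable ℂ G ∧ ∀ z, F z = (z - w) * G z := by
  refine ⟨dslope F w, ?_, fun z => ?_⟩
  · rw [← differentiableOn_univ] at hF ⊢
    exact (Complex.differentiableOn_dslope univ_mem).2 hF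
  · rw [← smul_eq_mul, sub_smul_dslope, hw, sub_zero]

theorem zeroCount_sub_mul {F G : ℂ → ℂ} (hG : Differentiable ℂ G) {w : ℂ}
    (hFG : ∀ z, F z = (z - w) * G z) {x : ℂ} (hx : F x ≠ 0) {R : ℝ} (hw : ‖w‖ ≤ R) :
    zeroCount F R = zeroCount G R + 1 := by
  have hGx : G x ≠ 0 := fun h => hx (by rw [hFG, h, mul_zero])
  have hGan : AnalyticOnNhd ℂ G Set.univ := fun z _ => hG.analyticAt z
  have hGtop : ∀ z, analyticOrderAt G z ≠ ⊤ := by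
    intro z hz
    have := (AnalyticOnNhd.analyticOrderAt_eq_top_iff_eq_zero z fun z => hG.analyticAt z).1 hz
    exact hGx (by rw [this]; rfl)
  have hLan : ∀ z, AnalyticAt ℂ (fun z => z - w) z := fun z => by fun_prop
  have hLw : analyticOrderAt (fun z => z - w) w = 1 := by
    rw [show (1 : ℕ∞) = ((1 : ℕ) : ℕ∞) from rfl, (hLan w).analyticOrderAt_eq_natCast]
    exact ⟨fun _ => 1, analyticAt_const, one_ne_zero, by simp⟩
  have hLne : ∀ z, z ≠ w → analyticOrderAt (fun z => z - w) z = 0 := fun z hz => by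
    rw [(hLan z).analyticOrderAt_eq_zero]
    exact sub_ne_zero.2 hz
  have hLtop : ∀ z, analyticOrderAt (fun z => z - w) z ≠ ⊤ := by
    intro z
    by_cases hz : z = w
    · rw [hz, hLw]; simp
    · rw [hLne z hz]; simp
  have hord : ∀ z, analyticOrderNatAt F z =
      analyticOrderNatAt (fun z => z - w) z + analyticOrderNatAt G z := by
    intro z
    rw [← analyticOrderNatAt_mul (hLan z) (hG.analyticAt z) (hLtop z) (hGtop z)]
    congr 1
    exact funext hFG
  -- Finiteness is essential: `∑ᶠ` defaults to 0 on infinite support.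
  have hfinG : (Metric.closedBall (0 : ℂ) R ∩ Function.support (analyticOrderNatAt G)).Finite := by
    have h1 := hGan.preimage_zero_mem_codiscrete hGx
    refine ((isCompact_closedBall (0 : ℂ) R).finite_sdiff_of_mem_codiscreteWithin
      (codiscreteWithin_mono (Set.subset_univ _) h1)).subset fun z hz => ⟨hz.1, ?_⟩
    simpa using apply_eq_zero_of_analyticOrderNatAt_ne_zero hz.2
  have hsuppL : Metric.closedBall (0 : ℂ) R ∩
      Function.support (analyticOrderNatAt fun z => z - w) ⊆ {w} := by
    intro z hz
    by_contra hne
    exact hz.2 (by simp [analyticOrderNatAt, hLne z hne])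
  unfold zeroCount
  simp only [hord]
  rw [finsum_mem_add_distrib' ((Set.finite_singleton w).subset hsuppL) hfinG, add_comm]
  congr 1
  rw [finsum_mem_inter_support_eq _ _ {w}, finsum_mem_singleton]
  · simp [analyticOrderNatAt, hLw]
  · refine Set.Subset.antisymm (fun z hz => ⟨hsuppL hz, hz.2⟩) ?_
    rintro z ⟨rfl, h2⟩
    exact ⟨by simpa using hw, h2⟩

/-- The zeros of an entire function in a closed disk can be divided out. -/
theorem exists_factorization_closedBall {F : ℂ → ℂ} (hF : Differentiable ℂ F) {x : ℂ}
    (hx : F x ≠ 0) (R : ℝ) :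
    ∃ (s : Multiset ℂ) (g : ℂ → ℂ), Differentiable ℂ g ∧ s.card ≤ zeroCount F R ∧
      (∀ w ∈ s, ‖w‖ ≤ R) ∧ (∀ z, F z = (s.map fun w => z - w).prod * g z) ∧
      ∀ z : ℂ, ‖z‖ ≤ R → g z ≠ 0 := by
  induction hn : zeroCount F R using Nat.strong_induction_on generalizing F with
  | _ n ih =>
    by_cases hz : ∃ w : ℂ, ‖w‖ ≤ R ∧ F w = 0
    · obtain ⟨w, hw, hFw⟩ := hz
      obtain ⟨G, hG, hFG⟩ := exists_eq_sub_mul_of_eq_zero hF hFw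
      have hc := zeroCount_sub_mul hG hFG hx hw
      obtain ⟨s, g, hg, hs, hsR, hGg, hg0⟩ := ih (zeroCount G R) (by omega) hG
        (fun h => hx (by rw [hFG, h, mul_zero])) rfl
      refine ⟨w ::ₘ s, g, hg, by simp; omega, ?_, fun z => ?_, hg0⟩
      · simpa [hw] using hsR
      · rw [hFG, hGg]; simp [mul_assoc]
    · push Not at hz
      exact ⟨0, F, hF, by simp, by simp, by simp, hz⟩

/-- After squaring, this is (R² - ‖z‖²)(R² - ‖w‖²) ≥ 0. -/
theorem norm_sub_le_norm_blaschke_denominator {R : ℝ} (hR : 0 < R) {z w : ℂ} (hz : ‖z‖ ≤ R)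
    (hw : ‖w‖ ≤ R) : ‖z - w‖ ≤ ‖(R : ℂ) - (starRingEnd ℂ) w * z / R‖ := by
  have hR' : (R : ℂ) ≠ 0 := by exact_mod_cast hR.ne'
  have e : (R : ℂ) - (starRingEnd ℂ) w * z / R = ((R : ℂ) ^ 2 - (starRingEnd ℂ) w * z) / R := by
    field_simp
  rw [e, norm_div, Complex.norm_real, Real.norm_eq_abs, abs_of_pos hR, le_div_iff₀ hR]
  refine abs_le_of_sq_le_sq' ?_ (norm_nonneg _) |>.2
  have h1 : ‖z‖ ^ 2 ≤ R ^ 2 := by gcongr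
  have h2 : ‖w‖ ^ 2 ≤ R ^ 2 := by gcongr
  have h3 := mul_nonneg (sub_nonneg.2 h1) (sub_nonneg.2 h2)
  rw [mul_pow]
  simp only [Complex.sq_norm, Complex.normSq_apply] at h3 ⊢
  simp only [Complex.sub_re, Complex.sub_im, Complex.mul_re, Complex.mul_im, Complex.conj_re,
    Complex.conj_im, ← Complex.ofReal_pow, Complex.ofReal_re, Complex.ofReal_im]
  nlinarith [h3]

/-- A form of Jensen's inequality. Roots inside radius ρ become Blaschke denominators, equal to ρ at
the origin; roots outside already have modulus at least ρ. -/
theorem norm_mul_pow_card_le {g : ℂ → ℂ} (hg : Differentiable ℂ g) (s : Multiset ℂ) {ρ A : ℝ}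
    (hρ : 0 < ρ) (hb : ∀ z : ℂ, ‖z‖ = ρ → ‖(s.map fun w => z - w).prod * g z‖ ≤ A) :
    ‖g 0‖ * ρ ^ s.card ≤ A := by
  set s₁ := s.filter fun w => ‖w‖ ≤ ρ
  set s₂ := s.filter fun w => ¬ ‖w‖ ≤ ρ
  have hs : s₁ + s₂ = s := Multiset.filter_add_not _ s
  have hd : Differentiable ℂ fun z => (s₂.map fun w => z - w).prod * g z := by
    apply Differentiable.mul _ hg
    induction s₂ using Multiset.induction_on with
    | empty => simp
    | cons a s ih => simp only [Multiset.map_cons, Multiset.prod_cons]; fun_prop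
  have h1 := norm_mul_prod_le_of_forall_norm_eq hd s₁ hρ (A := A) (fun z hz => by
    rw [← mul_assoc, ← Multiset.prod_add, ← Multiset.map_add, hs]
    exact hb z hz) (z := 0) (by simpa using hρ.le)
  refine le_trans ?_ h1
  have e1 : (s₁.map fun w => (ρ : ℂ) - (starRingEnd ℂ) w * 0 / ρ).prod = (ρ : ℂ) ^ s₁.card := by
    simp
  rw [e1, norm_mul, norm_mul, norm_pow, Complex.norm_real, Real.norm_eq_abs, abs_of_pos hρ,
    norm_prod_map, ← hs, Multiset.card_add, pow_add]
  have h2 : ρ ^ s₂.card ≤ (s₂.map fun w => ‖(0 : ℂ) - w‖).prod := by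
    have h3 : ∀ w ∈ s₂, ρ ≤ ‖(0 : ℂ) - w‖ := fun w hw => by
      have := (Multiset.mem_filter.1 hw).2
      simpa using (not_le.1 this).le
    have := Multiset.prod_map_le_prod_map₀ (s := s₂) (fun _ => ρ) _ (fun _ _ => hρ.le) h3
    simpa using this
  calc ‖g 0‖ * (ρ ^ s₁.card * ρ ^ s₂.card) = ρ ^ s₁.card * (ρ ^ s₂.card * ‖g 0‖) := by ring
    _ ≤ _ := by gcongr

/-! ### Few zeros force an exponential majorant -/

/-- An entire function of exponential type one with few zeros is bounded by an exponential
function in a smaller disk. -/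
theorem exists_norm_le_exp_of_zeroCount_le {F : ℂ → ℂ} (hF : Differentiable ℂ F)
    (hb : ∀ z, ‖F z‖ ≤ Real.exp ‖z‖) (h0 : ‖F 0‖ = 1) {R T : ℝ} (hT : 0 < T)
    (hTR : 24000000 * T ≤ R) (hRT : R ≤ 48000000 * T)
    (hc : (zeroCount F R : ℝ) ≤ 1 / 10 ^ 11 * R) :
    ∃ a : ℂ, ‖a‖ ≤ 2 ∧ ∀ z : ℂ, ‖z‖ ≤ 1000 * T → ‖F z‖ ≤ Real.exp ((a * z).re + T) := by
  have hR : 0 < R := by linarith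
  have hF0 : F 0 ≠ 0 := by rw [← norm_ne_zero_iff, h0]; exact one_ne_zero
  obtain ⟨s, g, hg, hs, hsR, hFg, hg0⟩ := exists_factorization_closedBall hF hF0 R
  set H : ℂ → ℂ := fun z => (s.map fun w => (R : ℂ) - (starRingEnd ℂ) w * z / R).prod * g z
    with hH
  have hHd : Differentiable ℂ H := by
    apply Differentiable.mul _ hg
    clear_value H
    clear hs hsR hFg hH
    induction s using Multiset.induction_on with
    | empty => simp
    | cons a s ih => simp only [Multiset.map_cons, Multiset.prod_cons]; fun_prop
  have hHb : ∀ z ∈ Metric.ball (0 : ℂ) R, ‖H z‖ ≤ Real.exp R := fun z hz =>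
    norm_mul_prod_le_of_forall_norm_eq hg s hR (fun z hz => by
      rw [← hFg, ← hz]; exact hb z) (by simpa using (mem_ball_zero_iff.1 hz).le)
  have hHne : ∀ z ∈ Metric.ball (0 : ℂ) R, H z ≠ 0 := by
    intro z hz
    have hz' := mem_ball_zero_iff.1 hz
    refine mul_ne_zero (Multiset.prod_ne_zero ?_) (hg0 z hz'.le)
    intro h
    obtain ⟨w, hw, hw0⟩ := Multiset.mem_map.1 h
    have h2 : ‖(R : ℂ)‖ = ‖(starRingEnd ℂ) w * z / R‖ :=
      congrArg norm (sub_eq_zero.1 hw0)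
    rw [norm_div, norm_mul, Complex.norm_conj, Complex.norm_real, Real.norm_eq_abs,
      abs_of_pos hR, eq_div_iff hR.ne'] at h2
    nlinarith [hsR w hw, norm_nonneg z, norm_nonneg w]
  have hFH : ∀ z : ℂ, ‖z‖ ≤ R → ‖F z‖ ≤ ‖H z‖ := by
    intro z hz
    rw [hFg, hH, norm_mul, norm_mul, norm_prod_map, norm_prod_map]
    gcongr
    exact Multiset.prod_map_le_prod_map₀ _ _ (fun _ _ => norm_nonneg _)
      fun w hw => norm_sub_le_norm_blaschke_denominator hR hz (hsR w hw)
  have hH1 : 1 ≤ ‖H 0‖ := h0 ▸ hFH 0 (by simpa using hR.le)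
  -- Jensen at radius γR costs e^{γR}, and each zero a factor 1/γ ≤ e^36; with at most R/10^11 zeros
  -- the total exponent stays below T/2.
  set γ : ℝ := 1 / 10 ^ 9 with hγ
  have hγ0 : 0 < γ := by positivity
  have hsmall := norm_mul_pow_card_le hg s (ρ := γ * R) (A := Real.exp (γ * R)) (by positivity)
    fun z hz => by rw [← hFg, ← hz]; exact hb z
  have hH0 : ‖H 0‖ ≤ Real.exp (T / 2) := by
    have e : ‖H 0‖ = ‖g 0‖ * (γ * R) ^ s.card * (10 ^ 9) ^ s.card := by
      simp only [hH, mul_zero, zero_div, sub_zero, Multiset.map_const', Multiset.prod_replicate,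
        norm_mul, norm_pow, Complex.norm_real, Real.norm_eq_abs, abs_of_pos hR]
      rw [mul_assoc, ← mul_pow, hγ]
      field_simp
    have h10 : (10 : ℝ) ^ 9 ≤ Real.exp 36 := by
      have h3 : (2 : ℝ) ≤ Real.exp 1 := by linarith [Real.exp_one_gt_d9]
      calc (10 : ℝ) ^ 9 ≤ 2 ^ 36 := by norm_num
        _ ≤ Real.exp 1 ^ 36 := by gcongr
        _ = Real.exp 36 := by rw [← Real.exp_nat_mul]; norm_num
    have hcard : (s.card : ℝ) ≤ 1 / 10 ^ 11 * R := le_trans (by exact_mod_cast hs) hc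
    calc ‖H 0‖ = ‖g 0‖ * (γ * R) ^ s.card * (10 ^ 9) ^ s.card := e
      _ ≤ Real.exp (γ * R) * Real.exp 36 ^ s.card := by gcongr
      _ = Real.exp (γ * R + s.card * 36) := by rw [← Real.exp_nat_mul, ← Real.exp_add]
      _ ≤ Real.exp (T / 2) := by
        gcongr
        rw [hγ]
        linarith
  obtain ⟨a, ha, hw⟩ := exists_linear_exponent hR hR hHd.differentiableOn hHne hHb hH1
  refine ⟨a, ha.trans_eq (by field_simp), fun z hz => (hFH z (by linarith)).trans ?_⟩
  obtain ⟨w, hzw, hwb⟩ := hw z (by linarith)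
  -- The quadratic error is at most 12·10^6·T²/R, which dictates R ≥ 24000000 T.
  have hw2 : w.re ≤ T / 2 := by
    refine (Complex.re_le_norm w).trans (hwb.trans ?_)
    calc 12 * R * (‖z‖ / R) ^ 2 ≤ 12 * R * (1000 * T / R) ^ 2 := by gcongr
      _ = 12000000 * T * T / R := by field_simp; ring
      _ ≤ T / 2 := by
        rw [div_le_iff₀ hR]
        nlinarith
  rw [hzw, norm_mul, Complex.norm_exp]
  calc ‖H 0‖ * Real.exp (a * z + w).re ≤ Real.exp (T / 2) * Real.exp ((a * z).re + T / 2) := by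
        rw [Complex.add_re]; gcongr
    _ = Real.exp ((a * z).re + T) := by rw [← Real.exp_add]; congr 1; ring

/-! ### Zero-freeness from moduli at the integers -/

theorem exists_eq_prod_range_sub_mul {P : ℂ → ℂ} (hP : Differentiable ℂ P) (N : ℕ)
    (h0 : ∀ n < N, P n = 0) :
    ∃ S : ℂ → ℂ, Differentiable ℂ S ∧ ∀ z, P z = (∏ n ∈ Finset.range N, (z - n)) * S z := by
  induction N with
  | zero => exact ⟨P, hP, by simp⟩
  | succ N ih =>
    obtain ⟨S, hS, hPS⟩ := ih fun n hn => h0 n (by omega)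
    have hSN : S N = 0 := by
      have := h0 N (by omega)
      rw [hPS] at this
      refine (mul_eq_zero.1 this).resolve_left (Finset.prod_ne_zero_iff.2 fun n hn => ?_)
      rw [sub_ne_zero]
      exact_mod_cast (Finset.mem_range.1 hn).ne'
    obtain ⟨S', hS', hSS'⟩ := exists_eq_sub_mul_of_eq_zero hS hSN
    refine ⟨S', hS', fun z => ?_⟩
    rw [hPS, hSS', Finset.prod_range_succ, mul_assoc]

/-- Cut the product into L blocks of length T; the factors of block j (from 0) are at most (j + 2)T.
-/
theorem prod_range_add_le (T L : ℕ) :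
    (∏ n ∈ Finset.range (L * T), ((T : ℝ) + n)) ≤ ((L + 1).factorial : ℝ) ^ T * (T : ℝ) ^ (L * T) := by
  induction L with
  | zero => simp
  | succ L ih =>
    rw [Nat.succ_mul, Finset.prod_range_add]
    have h : (∏ x ∈ Finset.range T, ((T : ℝ) + ((L * T + x : ℕ) : ℝ))) ≤ (((L + 2 : ℕ) : ℝ) * T) ^ T := by
      refine (Finset.prod_le_prod (g := fun _ => ((L + 2 : ℕ) : ℝ) * T)
        (fun _ _ => by positivity) fun x hx => ?_).trans_eq (by simp)
      have : (x : ℝ) ≤ T := by exact_mod_cast (Finset.mem_range.1 hx).le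
      push_cast
      linarith
    calc _ ≤ (((L + 1).factorial : ℝ) ^ T * (T : ℝ) ^ (L * T)) * (((L + 2 : ℕ) : ℝ) * T) ^ T := by
          gcongr
      _ = _ := by
        rw [Nat.factorial_succ (L + 1), pow_add, Nat.cast_mul, mul_pow, mul_pow]
        push_cast
        ring

/-- The numerical margin behind zero-freeness: 101! comes from the product over integer nodes, 99
from the Blaschke denominators, and 85 = 82 + 2 + 1 from the growth of P, its factor 5 and its lower
bound e^{-T}. -/
theorem factorial_mul_exp_lt : ((101).factorial : ℝ) * Real.exp 85 < 99 ^ 100 := by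
  have h : Real.exp 85 ≤ 2.7182818286 ^ 85 := by
    rw [show (85 : ℝ) = ((85 : ℕ) : ℝ) * 1 by norm_num, Real.exp_nat_mul]
    have := Real.exp_one_lt_d9.le
    gcongr
  calc ((101).factorial : ℝ) * Real.exp 85 ≤ ((101).factorial : ℝ) * 2.7182818286 ^ 85 := by gcongr
    _ < 99 ^ 100 := by norm_num [Nat.factorial]

/-- An entire function of slow growth with moduli in geometric progression at the natural numbers
has no zeros near the origin. -/
theorem ne_zero_of_norm_natCast_eq_exp {Q : ℂ → ℂ} (hQ : Differentiable ℂ Q) {T : ℕ} (hT : 0 < T)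
    {l : ℝ} (hl : |l| ≤ 4 / 5) (hb : ∀ z : ℂ, ‖z‖ ≤ 100 * T → ‖Q z‖ ≤ 2 * Real.exp T)
    (hn : ∀ n < 100 * T, ‖Q n‖ = Real.exp (-(l * n))) {z : ℂ} (hz : ‖z‖ ≤ T) : Q z ≠ 0 := by
  intro hz0
  have hT0 : (0 : ℝ) < T := by exact_mod_cast hT
  have hT1 : (1 : ℝ) ≤ T := by exact_mod_cast hT
  -- Conjugating both argument and value keeps the second factor entire, while at a natural number
  -- it is the conjugate of Q, so |Q|² appears there.
  set P : ℂ → ℂ := fun z =>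
    Q z * (starRingEnd ℂ) (Q ((starRingEnd ℂ) z)) * Complex.exp (l * z) - Complex.exp (-(l * z))
    with hP
  have hPd : Differentiable ℂ P := by
    have hQc : Differentiable ℂ fun z => (starRingEnd ℂ) (Q ((starRingEnd ℂ) z)) := fun z => by
      have := (hQ ((starRingEnd ℂ) z)).conj_conj
      rw [Complex.conj_conj] at this
      exact this
    fun_prop
  have hP0 : ∀ n < 100 * T, P n = 0 := by
    intro n hn'
    simp only [hP]
    rw [Complex.conj_natCast, Complex.mul_conj', hn n hn', sub_eq_zero]
    push_cast
    rw [← Complex.exp_nat_mul, ← Complex.exp_add]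
    congr 1
    push_cast
    ring
  obtain ⟨S, hS, hPS⟩ := exists_eq_prod_range_sub_mul hPd (100 * T) hP0
  set s : Multiset ℂ := (Multiset.range (100 * T)).map fun n : ℕ => (n : ℂ)
  have hlre : ∀ w : ℂ, |((l : ℂ) * w).re| ≤ 4 / 5 * ‖w‖ := by
    intro w
    rw [Complex.re_ofReal_mul, abs_mul]
    exact mul_le_mul hl (Complex.abs_re_le_norm w) (abs_nonneg _) (by norm_num)
  have hPb : ∀ w : ℂ, ‖w‖ = 100 * T → ‖P w‖ ≤ 5 * Real.exp (82 * T) := by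
    intro w hw
    have h1 := hb w hw.le
    have h2 := hb ((starRingEnd ℂ) w) (by rw [Complex.norm_conj]; exact hw.le)
    have h3 := abs_le.1 (hlre w)
    rw [hw] at h3
    calc ‖P w‖ ≤ ‖Q w‖ * ‖Q ((starRingEnd ℂ) w)‖ * Real.exp ((l : ℂ) * w).re
          + Real.exp (-((l : ℂ) * w)).re := by
          refine (norm_sub_le _ _).trans ?_
          rw [norm_mul, norm_mul, Complex.norm_conj, Complex.norm_exp, Complex.norm_exp]
      _ ≤ (2 * Real.exp T) * (2 * Real.exp T) * Real.exp (80 * T) + Real.exp (82 * T) := by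
          gcongr
          · linarith
          · rw [Complex.neg_re]; linarith
      _ = 5 * Real.exp (82 * T) := by
          rw [show (82 : ℝ) * T = T + T + 80 * T by ring, Real.exp_add, Real.exp_add]
          ring
  have hbl := norm_mul_prod_le_of_forall_norm_eq hS s (R := 100 * T) (A := 5 * Real.exp (82 * T))
    (by positivity) (fun w hw => by
      have := hPb w hw
      rw [hPS] at this
      simpa [s, Finset.prod] using this) (z := z) (by linarith)
  rw [norm_mul, norm_prod_map] at hbl
  have hden : ((99 : ℝ) * T) ^ (100 * T) ≤
      (s.map fun w => ‖((100 * T : ℝ) : ℂ) - (starRingEnd ℂ) w * z / ((100 * T : ℝ) : ℂ)‖).prod := by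
    have h3 : ∀ w ∈ s, (99 : ℝ) * T ≤
        ‖((100 * T : ℝ) : ℂ) - (starRingEnd ℂ) w * z / ((100 * T : ℝ) : ℂ)‖ := by
      intro w hw
      obtain ⟨n, hn, rfl⟩ := Multiset.mem_map.1 hw
      have hn' : (n : ℝ) ≤ 100 * T := by exact_mod_cast (Multiset.mem_range.1 hn).le
      refine le_trans ?_ (norm_sub_norm_le _ _)
      rw [norm_div, norm_mul, Complex.norm_conj, Complex.norm_real, Real.norm_eq_abs,
        abs_of_pos (by positivity), Complex.norm_natCast]
      have : (n : ℝ) * ‖z‖ / (100 * T) ≤ T := by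
        rw [div_le_iff₀ (by positivity)]
        calc (n : ℝ) * ‖z‖ ≤ (100 * T) * T := by gcongr
          _ = _ := by ring
      linarith
    have := Multiset.prod_map_le_prod_map₀ (s := s) (fun _ => (99 : ℝ) * T) _
      (fun _ _ => by positivity) h3
    simpa [s] using this
  -- At a zero of Q only the term e^{-lz} survives.
  have hPz : Real.exp (-T) ≤ ‖P z‖ := by
    simp only [hP, hz0, zero_mul, zero_sub, norm_neg, Complex.norm_exp, Complex.neg_re]
    have := (abs_le.1 (hlre z)).2
    gcongr
    linarith
  obtain ⟨f, hf⟩ : ∃ f : ℝ, f = ((101).factorial : ℝ) := ⟨_, rfl⟩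
  have hf0 : 0 ≤ f := by rw [hf]; positivity
  have hfact := factorial_mul_exp_lt
  have hprod := prod_range_add_le T 100
  rw [← hf] at hfact hprod
  have hnum : ‖P z‖ ≤ f ^ T * (T : ℝ) ^ (100 * T) * ‖S z‖ := by
    rw [hPS, norm_mul, norm_prod]
    gcongr
    refine le_trans (Finset.prod_le_prod (fun _ _ => norm_nonneg _) fun n _ => ?_)
      hprod
    refine (norm_sub_le _ _).trans ?_
    rw [Complex.norm_natCast]
    linarith
  have hSb : ((99 : ℝ) * T) ^ (100 * T) * ‖S z‖ ≤ 5 * Real.exp (82 * T) :=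
    le_trans (by gcongr) hbl
  have h5 : (5 : ℝ) ≤ Real.exp (2 * T) := by
    have h3 : (2.7 : ℝ) ≤ Real.exp 1 := by linarith [Real.exp_one_gt_d9]
    calc (5 : ℝ) ≤ 2.7 ^ 2 := by norm_num
      _ ≤ Real.exp 1 ^ 2 := by gcongr
      _ = Real.exp 2 := by rw [← Real.exp_nat_mul]; norm_num
      _ ≤ Real.exp (2 * T) := by gcongr; linarith
  have hfin : (99 : ℝ) ^ (100 * T) ≤ (f * Real.exp 85) ^ T := by
    have hTp : (0 : ℝ) < (T : ℝ) ^ (100 * T) := by positivity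
    refine le_of_mul_le_mul_right ?_ hTp
    calc (99 : ℝ) ^ (100 * T) * (T : ℝ) ^ (100 * T)
        = ((99 : ℝ) * T) ^ (100 * T) * Real.exp (-T) * Real.exp T := by
          rw [mul_assoc, ← Real.exp_add, neg_add_cancel, Real.exp_zero, mul_one, mul_pow]
      _ ≤ ((99 : ℝ) * T) ^ (100 * T) *
          (f ^ T * (T : ℝ) ^ (100 * T) * ‖S z‖) * Real.exp T := by
          gcongr
          exact hPz.trans hnum
      _ = f ^ T * (T : ℝ) ^ (100 * T) *
          (((99 : ℝ) * T) ^ (100 * T) * ‖S z‖) * Real.exp T := by ring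
      _ ≤ f ^ T * (T : ℝ) ^ (100 * T) *
          (Real.exp (2 * T) * Real.exp (82 * T)) * Real.exp T := by
          have := hSb.trans (mul_le_mul_of_nonneg_right h5 (Real.exp_pos _).le)
          gcongr
      _ = (f * Real.exp 85) ^ T * (T : ℝ) ^ (100 * T) := by
          rw [mul_pow, ← Real.exp_nat_mul, show (T : ℝ) * 85 = 2 * T + 82 * T + T by ring,
            Real.exp_add, Real.exp_add]
          ring
  rw [pow_mul] at hfin
  exact absurd hfin (not_le.2 (pow_lt_pow_left₀ hfact (by positivity) hT.ne'))

/-! ### Series with unimodular coefficients -/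

section ExponentialGeneratingFunction

variable {ω : ℕ → ℂ} {F : ℂ → ℂ}

theorem hasFPowerSeriesOnBall_of_norm_eq_one (hω : ∀ n, ‖ω n‖ = 1)
    (hF : ∀ z : ℂ, HasSum (fun n : ℕ => ω n * (z ^ n / (Nat.factorial n : ℂ))) (F z)) :
    HasFPowerSeriesOnBall F
      (FormalMultilinearSeries.ofScalars ℂ fun n => ω n / (Nat.factorial n : ℂ)) 0 ⊤ where
  r_le := by
    refine (FormalMultilinearSeries.radius_eq_top_of_summable_norm _ fun r => ?_).ge
    refine (Real.summable_pow_div_factorial (r : ℝ)).congr fun n => ?_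
    rw [FormalMultilinearSeries.ofScalars_norm, norm_div, hω, Complex.norm_natCast]
    ring
  r_pos := by simp
  hasSum := by
    intro y _
    rw [zero_add]
    refine (hF y).congr_fun fun n => ?_
    rw [FormalMultilinearSeries.ofScalars_apply_eq]
    simp only [smul_eq_mul]
    ring

theorem differentiable_of_norm_eq_one (hω : ∀ n, ‖ω n‖ = 1)
    (hF : ∀ z : ℂ, HasSum (fun n : ℕ => ω n * (z ^ n / (Nat.factorial n : ℂ))) (F z)) :
    Differentiable ℂ F := by
  have := (hasFPowerSeriesOnBall_of_norm_eq_one hω hF).differentiableOn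
  simpa [differentiableOn_univ] using this

theorem iteratedDeriv_zero_of_norm_eq_one (hω : ∀ n, ‖ω n‖ = 1)
    (hF : ∀ z : ℂ, HasSum (fun n : ℕ => ω n * (z ^ n / (Nat.factorial n : ℂ))) (F z)) (n : ℕ) :
    iteratedDeriv n F 0 = ω n := by
  have := (hasFPowerSeriesOnBall_of_norm_eq_one hω hF).factorial_smul 1 n
  rw [iteratedDeriv_eq_iteratedFDeriv, ← this, FormalMultilinearSeries.ofScalars_apply_eq]
  have : (n.factorial : ℂ) ≠ 0 := by exact_mod_cast n.factorial_ne_zero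
  simp only [one_pow, smul_eq_mul, mul_one, nsmul_eq_mul]
  field_simp

theorem norm_le_exp_norm_of_norm_eq_one (hω : ∀ n, ‖ω n‖ = 1)
    (hF : ∀ z : ℂ, HasSum (fun n : ℕ => ω n * (z ^ n / (Nat.factorial n : ℂ))) (F z)) (z : ℂ) :
    ‖F z‖ ≤ Real.exp ‖z‖ := by
  have h := NormedSpace.expSeries_div_hasSum_exp (𝔸 := ℝ) ‖z‖
  rw [← Real.exp_eq_exp_ℝ] at h
  rw [← (hF z).tsum_eq]
  refine tsum_of_norm_bounded h fun n => ?_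
  rw [norm_mul, hω, norm_div, norm_pow, Complex.norm_natCast, one_mul]

theorem eq_mul_exp_of_mul_eq_sq (hω : ∀ n, ‖ω n‖ = 1)
    (hF : ∀ z : ℂ, HasSum (fun n : ℕ => ω n * (z ^ n / (Nat.factorial n : ℂ))) (F z))
    (h : ∀ n, ω (n + 2) * ω n = ω (n + 1) ^ 2) :
    ∃ Θ α : ℂ, ‖Θ‖ = 1 ∧ ‖α‖ = 1 ∧ ∀ z : ℂ, F z = Θ * Complex.exp (α * z) := by
  have hne : ∀ n, ω n ≠ 0 := fun n => by rw [← norm_ne_zero_iff, hω]; exact one_ne_zero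
  have hstep : ∀ n, ω (n + 1) = ω n * (ω 1 / ω 0) := by
    intro n
    induction n with
    | zero => field_simp [hne 0]
    | succ n ih =>
      have h2 := h n
      rw [pow_two] at h2
      nth_rw 2 [ih] at h2
      exact mul_right_cancel₀ (hne n) (by rw [h2]; ring)
  have hgeom : ∀ n, ω n = ω 0 * (ω 1 / ω 0) ^ n := by
    intro n
    induction n with
    | zero => simp
    | succ n ih => rw [hstep, ih]; ring
  refine ⟨ω 0, ω 1 / ω 0, hω 0, by rw [norm_div, hω, hω, div_one], fun z => ?_⟩
  have h2 := (NormedSpace.expSeries_div_hasSum_exp (𝔸 := ℂ) (ω 1 / ω 0 * z)).mul_left (ω 0)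
  rw [← Complex.exp_eq_exp_ℂ] at h2
  refine (hF z).unique (h2.congr_fun ?_)
  intro n
  rw [hgeom n, mul_pow]
  ring

end ExponentialGeneratingFunction

/-! ### Interpolation of the coefficients -/

/-- Cauchy's estimates give r^n/n! ≤ e^B; weighting by 2^{-n} and summing yields e^{r/2} ≤ 2e^B.
This serves to keep |a| away from 0. -/
theorem one_half_mul_le_of_norm_le_exp {F : ℂ → ℂ} (hF : Differentiable ℂ F)
    (hd : ∀ n, ‖iteratedDeriv n F 0‖ = 1) {r B : ℝ} (hr : 0 < r)
    (hb : ∀ z : ℂ, ‖z‖ = r → ‖F z‖ ≤ Real.exp B) : r / 2 ≤ B + 1 := by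
  have h1 : ∀ n : ℕ, (r / 2) ^ n / n.factorial ≤ Real.exp B * (1 / 2) ^ n := by
    intro n
    have h2 := Complex.norm_iteratedDeriv_le_of_forall_mem_sphere_norm_le n hr
      hF.diffContOnCl (c := 0) (C := Real.exp B) fun z hz => hb z (by simpa using hz)
    rw [hd, le_div_iff₀ (by positivity)] at h2
    have h3 : (0 : ℝ) < n.factorial := by exact_mod_cast n.factorial_pos
    rw [div_le_iff₀ h3, div_pow, div_pow]
    have : (0 : ℝ) < 2 ^ n := by positivity
    rw [div_le_iff₀ this]
    calc r ^ n = 1 * r ^ n := by ring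
      _ ≤ _ := h2
      _ = _ := by field_simp; simp
  have hs := NormedSpace.expSeries_div_hasSum_exp (𝔸 := ℝ) (r / 2)
  rw [← Real.exp_eq_exp_ℝ] at hs
  have h2 := hasSum_le h1 hs (hasSum_geometric_two.mul_left (Real.exp B))
  have h3 : (2 : ℝ) ≤ Real.exp 1 := by linarith [Real.exp_one_gt_d9]
  rw [← Real.exp_le_exp, Real.exp_add]
  exact h2.trans (by gcongr)

theorem prod_range_natCast_sub_div_factorial (n k : ℕ) :
    (∏ i ∈ Finset.range k, ((n : ℂ) - i)) / (k.factorial : ℂ) = n.choose k := by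
  have : (k.factorial : ℂ) ≠ 0 := by exact_mod_cast k.factorial_ne_zero
  rw [← descPochhammer_eval_eq_prod_range, descPochhammer_eval_eq_descFactorial,
    Nat.descFactorial_eq_factorial_mul_choose, Nat.cast_mul, mul_div_cancel_left₀ _ this]

/-- Newton interpolation of the normalized Taylor coefficients of a function close to an
exponential. -/
theorem exists_interpolation_of_norm_le_exp {F : ℂ → ℂ} (hF : Differentiable ℂ F) {a : ℂ}
    (ha : 9 / 20 ≤ ‖a‖) {T : ℕ} (hT : 0 < T)
    (hb : ∀ z : ℂ, ‖z‖ ≤ 1000 * T → ‖F z‖ ≤ Real.exp ((a * z).re + T)) :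
    ∃ Q : ℂ → ℂ, Differentiable ℂ Q ∧
      (∀ n < 100 * T, Q n = iteratedDeriv n F 0 / a ^ n) ∧
      ∀ z : ℂ, ‖z‖ ≤ 100 * T → ‖Q z‖ ≤ 2 * Real.exp T := by
  have ha0 : a ≠ 0 := by rw [← norm_pos_iff]; linarith
  have hT0 : (0 : ℝ) < T := by exact_mod_cast hT
  set g : ℂ → ℂ := fun z => F z * Complex.exp (-(a * z)) with hg
  have hgd : Differentiable ℂ g := by fun_prop
  set d : ℕ → ℂ := fun k => iteratedDeriv k g 0 with hd
  have hdb : ∀ k, ‖d k‖ ≤ k.factorial * Real.exp T / (1000 * T) ^ k := by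
    intro k
    refine Complex.norm_iteratedDeriv_le_of_forall_mem_sphere_norm_le k (by positivity)
      hgd.diffContOnCl fun z hz => ?_
    have hz' : ‖z‖ = 1000 * T := by simpa using hz
    rw [hg, norm_mul, Complex.norm_exp]
    calc ‖F z‖ * Real.exp (-(a * z)).re ≤ Real.exp ((a * z).re + T) * Real.exp (-(a * z)).re := by
          gcongr
          exact hb z hz'.le
      _ = Real.exp T := by
          rw [← Real.exp_add, Complex.neg_re]
          congr 1
          ring
  have hFd : ∀ n, iteratedDeriv n F 0 =
      ∑ k ∈ Finset.range (n + 1), (n.choose k : ℂ) * d k * a ^ (n - k) := by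
    intro n
    have e : F = g * fun z => Complex.exp (a * z) := by
      ext z
      simp only [hg, Pi.mul_apply]
      rw [mul_assoc, ← Complex.exp_add, neg_add_cancel, Complex.exp_zero, mul_one]
    rw [e, iteratedDeriv_mul (hgd.contDiff.contDiffAt) (by fun_prop)]
    refine Finset.sum_congr rfl fun k _ => ?_
    rw [iteratedDeriv_cexp_const_mul]
    simp [hd]
  -- At z = n the Newton polynomials become binomial coefficients, so the sum stops at k = n and
  -- reproduces Leibniz's rule for F = g·e^{az}.
  refine ⟨fun z => ∑ k ∈ Finset.range (100 * T),
    d k / a ^ k * ((∏ i ∈ Finset.range k, (z - i)) / (k.factorial : ℂ)), by fun_prop, ?_, ?_⟩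
  · intro n hn
    simp only [prod_range_natCast_sub_div_factorial]
    rw [hFd, Finset.sum_div]
    symm
    refine Finset.sum_subset_zero_on_sdiff (Finset.range_mono (by omega)) ?_ ?_
    · intro k hk
      have : n < k := by simp at hk; omega
      rw [Nat.choose_eq_zero_of_lt this]
      simp
    · intro k hk
      have hk' : k ≤ n := by simpa [Nat.lt_succ_iff] using hk
      have e : a ^ n = a ^ (n - k) * a ^ k := by rw [← pow_add]; congr 1; omega
      rw [e]
      field_simp
  · intro z hz
    have hterm : ∀ k ∈ Finset.range (100 * T),
        ‖d k / a ^ k * ((∏ i ∈ Finset.range k, (z - i)) / (k.factorial : ℂ))‖ ≤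
          Real.exp T * (1 / 2) ^ k := by
      intro k hk
      have hk' : (k : ℝ) ≤ 100 * T := by exact_mod_cast (Finset.mem_range.1 hk).le
      have hkf : (0 : ℝ) < k.factorial := by exact_mod_cast k.factorial_pos
      have hprod : ‖∏ i ∈ Finset.range k, (z - i)‖ ≤ (200 * T : ℝ) ^ k := by
        rw [norm_prod]
        refine (Finset.prod_le_prod (g := fun _ => (200 * T : ℝ)) (fun _ _ => norm_nonneg _)
          fun i hi => ?_).trans_eq (by simp)
        have hi' : (i : ℝ) ≤ k := by exact_mod_cast (Finset.mem_range.1 hi).le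
        refine (norm_sub_le _ _).trans ?_
        rw [Complex.norm_natCast]
        linarith
      have hak : (9 / 20 : ℝ) ^ k ≤ ‖a‖ ^ k := by gcongr
      rw [norm_mul, norm_div, norm_div, norm_pow, Complex.norm_natCast]
      calc ‖d k‖ / ‖a‖ ^ k * (‖∏ i ∈ Finset.range k, (z - i)‖ / k.factorial)
          ≤ (k.factorial * Real.exp T / (1000 * T) ^ k) / (9 / 20) ^ k *
            ((200 * T : ℝ) ^ k / k.factorial) := by
            gcongr
            exact hdb k
        -- The ratio is 4/9; this is why the disk for F is ten times that for Q.
        _ = Real.exp T * (200 * T / (1000 * T * (9 / 20))) ^ k := by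
            rw [div_pow (200 * (T : ℝ)), mul_pow (1000 * (T : ℝ))]
            field_simp
        _ ≤ Real.exp T * (1 / 2) ^ k := by
            refine mul_le_mul_of_nonneg_left (pow_le_pow_left₀ (by positivity) ?_ k)
              (Real.exp_pos _).le
            rw [div_le_iff₀ (by positivity)]
            linarith
    refine (norm_sum_le_of_le _ hterm).trans ?_
    rw [← Finset.mul_sum, mul_comm]
    gcongr
    exact (summable_geometric_two.sum_le_tsum _ fun _ _ => by positivity).trans_eq
      tsum_geometric_two

/-- The second difference of the logarithms of the Taylor coefficients is small. -/
theorem exists_norm_le_mul_eq_sq_mul_exp {F : ℂ → ℂ} (hF : Differentiable ℂ F)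
    (hd : ∀ n, ‖iteratedDeriv n F 0‖ = 1) {a : ℂ} (ha : ‖a‖ ≤ 2) {T : ℕ} (hT : 0 < T)
    (hb : ∀ z : ℂ, ‖z‖ ≤ 1000 * T → ‖F z‖ ≤ Real.exp ((a * z).re + T))
    {n : ℕ} (hn : 2 * (n + 2) < T) :
    ∃ w : ℂ, ‖w‖ ≤ 144 * (n + 2) ^ 2 / T ∧
      iteratedDeriv (n + 2) F 0 * iteratedDeriv n F 0 =
        iteratedDeriv (n + 1) F 0 ^ 2 * Complex.exp w := by
  have hT0 : (0 : ℝ) < T := by exact_mod_cast hT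
  have hT1 : (1 : ℝ) ≤ T := by exact_mod_cast hT
  have ha1 : 9 / 20 ≤ ‖a‖ := by
    have := one_half_mul_le_of_norm_le_exp hF hd (r := 1000 * T) (B := ‖a‖ * (1000 * T) + T)
      (by positivity) fun z hz => (hb z hz.le).trans (by
        gcongr
        rw [← hz, ← norm_mul]
        exact Complex.re_le_norm _)
    nlinarith
  have ha0 : a ≠ 0 := by rw [← norm_pos_iff]; linarith
  obtain ⟨Q, hQ, hQn, hQb⟩ := exists_interpolation_of_norm_le_exp hF ha1 hT hb
  have hlog : |Real.log ‖a‖| ≤ 4 / 5 := by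
    have hpos : 0 < ‖a‖ := norm_pos_iff.2 ha0
    have hexp : (20 / 9 : ℝ) ≤ Real.exp (4 / 5) := by
      refine le_of_pow_le_pow_left₀ (n := 5) (by norm_num) (Real.exp_pos _).le ?_
      rw [← Real.exp_nat_mul, show ((5 : ℕ) : ℝ) * (4 / 5) = (4 : ℕ) * 1 by norm_num,
        Real.exp_nat_mul]
      calc (20 / 9 : ℝ) ^ 5 ≤ 2.718 ^ 4 := by norm_num
        _ ≤ Real.exp 1 ^ 4 := by
          gcongr
          linarith [Real.exp_one_gt_d9]
    rw [abs_le]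
    constructor
    · rw [Real.le_log_iff_exp_le hpos]
      refine le_trans ?_ ha1
      rw [Real.exp_neg]
      exact (inv_anti₀ (by norm_num) hexp).trans_eq (by norm_num)
    · rw [Real.log_le_iff_le_exp hpos]
      linarith
  have hQnorm : ∀ k < 100 * T, ‖Q k‖ = Real.exp (-(Real.log ‖a‖ * k)) := by
    intro k hk
    rw [hQn k hk, norm_div, hd, norm_pow, Real.exp_neg, mul_comm, Real.exp_nat_mul,
      Real.exp_log (norm_pos_iff.2 ha0), one_div]
  have h2 : (2 : ℝ) ≤ Real.exp T := by
    linarith [Real.add_one_le_exp (T : ℝ)]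
  -- A = 2T because 2e^T ≤ e^{2T}.
  obtain ⟨b, -, hQe⟩ := exists_linear_exponent (H := Q) (A := 2 * T) hT0 (by positivity)
    hQ.differentiableOn
    (fun z hz => ne_zero_of_norm_natCast_eq_exp hQ hT hlog hQb hQnorm (mem_ball_zero_iff.1 hz).le)
    (fun z hz => (hQb z (by linarith [mem_ball_zero_iff.1 hz])).trans (by
      rw [two_mul (T : ℝ), Real.exp_add]; gcongr))
    (by have := hQnorm 0 (by omega); simp at this; exact this.ge)
  have hk : ∀ k : ℕ, k ≤ n + 2 → ∃ w : ℂ, iteratedDeriv k F 0 = Q 0 * Complex.exp (b * k + w) * a ^ k ∧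
      ‖w‖ ≤ 24 * (n + 2) ^ 2 / T := by
    intro k hk
    have hkn : (k : ℝ) ≤ n + 2 := by exact_mod_cast hk
    have hnT : 2 * ((n : ℝ) + 2) < T := by exact_mod_cast hn
    obtain ⟨w, hw, hwb⟩ := hQe k (by rw [Complex.norm_natCast]; linarith)
    refine ⟨w, ?_, hwb.trans ?_⟩
    · rw [← hw, hQn k (by omega), div_mul_cancel₀ _ (pow_ne_zero _ ha0)]
    · rw [Complex.norm_natCast]
      calc 12 * (2 * (T : ℝ)) * (k / T) ^ 2 ≤ 12 * (2 * (T : ℝ)) * ((n + 2) / T) ^ 2 := by gcongr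
        _ = _ := by field_simp; ring
  obtain ⟨w₀, h₀, hw₀⟩ := hk n (by omega)
  obtain ⟨w₁, h₁, hw₁⟩ := hk (n + 1) (by omega)
  obtain ⟨w₂, h₂, hw₂⟩ := hk (n + 2) (by omega)
  -- The second difference cancels Q(0), the powers of a and the linear term b, leaving only the
  -- quadratic errors.
  refine ⟨w₂ + w₀ - 2 * w₁, ?_, ?_⟩
  · have h3 : ‖2 * w₁‖ = 2 * ‖w₁‖ := by simp
    have h4 := norm_sub_le (w₂ + w₀) (2 * w₁)
    have h5 := norm_add_le w₂ w₀
    have h6 : 144 * ((n : ℝ) + 2) ^ 2 / T = 6 * (24 * (n + 2) ^ 2 / T) := by ring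
    have h7 : (0 : ℝ) ≤ 24 * ((n : ℝ) + 2) ^ 2 / T := by positivity
    linarith
  · have e : Complex.exp (b * ((n + 2 : ℕ) : ℂ) + w₂) * Complex.exp (b * n + w₀) =
        Complex.exp (b * ((n + 1 : ℕ) : ℂ) + w₁) ^ 2 * Complex.exp (w₂ + w₀ - 2 * w₁) := by
      rw [← Complex.exp_nat_mul, ← Complex.exp_add, ← Complex.exp_add]
      congr 1
      push_cast
      ring
    rw [h₀, h₁, h₂]
    linear_combination Q 0 ^ 2 * a ^ (n + 2) * a ^ n * e

/-! ### Conclusion: letting T tend to infinity -/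

theorem theorem1 :
    ∃ c : ℝ, 0 < c ∧
      ∀ (ω : ℕ → ℂ) (F : ℂ → ℂ),
        (∀ n, ‖ω n‖ = 1) →
        (∀ z : ℂ, HasSum (fun n : ℕ => ω n * (z ^ n / (Nat.factorial n : ℂ))) (F z)) →
          (∃ Θ α : ℂ, ‖Θ‖ = 1 ∧ ‖α‖ = 1 ∧ ∀ z : ℂ, F z = Θ * Complex.exp (α * z)) ∨
            (c : EReal) ≤
              liminf (fun R : ℝ => (((zeroCount F R : ℝ) / R : ℝ) : EReal)) atTop := by
  refine ⟨1 / 10 ^ 11, by positivity, fun ω F hω hF => ?_⟩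
  rw [or_iff_not_imp_right, not_le]
  intro hlt
  have hfreq : ∃ᶠ R : ℝ in atTop, (zeroCount F R : ℝ) / R < 1 / 10 ^ 11 := by
    refine (frequently_lt_of_liminf_lt (by isBoundedDefault) hlt).mono fun R hR => ?_
    exact_mod_cast hR
  have hFd := differentiable_of_norm_eq_one hω hF
  have hFb := norm_le_exp_norm_of_norm_eq_one hω hF
  have hFn := iteratedDeriv_zero_of_norm_eq_one hω hF
  have hF0 : ‖F 0‖ = 1 := by
    have := hFn 0
    rw [iteratedDeriv_zero] at this
    rw [this, hω]
  refine eq_mul_exp_of_mul_eq_sq hω hF fun n => ?_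
  have hseq : ∀ N : ℕ, ∃ w : ℂ, ‖w‖ ≤ 144 * (n + 2) ^ 2 / ((N : ℝ) + 1) ∧
      ω (n + 2) * ω n = ω (n + 1) ^ 2 * Complex.exp w := by
    intro N
    obtain ⟨R, hRc, hRN⟩ := (hfreq.and_eventually
      (eventually_ge_atTop (24000000 * ((N : ℝ) + 2 * n + 5)))).exists
    have hN0 : (0 : ℝ) ≤ N := N.cast_nonneg
    have hn0 : (0 : ℝ) ≤ n := n.cast_nonneg
    have hR0 : 0 < R := by linarith
    -- Since T ≥ 1, rounding down loses at most a factor two, hence R ≤ 48000000 T.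
    set T := ⌊R / 24000000⌋₊ with hTdef
    have hTN : N + 2 * n + 5 ≤ T := by
      rw [hTdef, Nat.le_floor_iff (by positivity), le_div_iff₀ (by norm_num)]
      push_cast
      linarith
    have hT1 : (1 : ℝ) ≤ T := by exact_mod_cast (by omega : 1 ≤ T)
    have hTR : (T : ℝ) ≤ R / 24000000 := Nat.floor_le (by positivity)
    have hRT : R / 24000000 < T + 1 := Nat.lt_floor_add_one _
    obtain ⟨a, ha, hab⟩ := exists_norm_le_exp_of_zeroCount_le hFd hFb hF0 (R := R) (T := T)
      (by linarith) (by linarith) (by linarith) ((div_lt_iff₀ hR0).1 hRc).le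
    obtain ⟨w, hw, hwe⟩ := exists_norm_le_mul_eq_sq_mul_exp hFd (fun n => by rw [hFn, hω]) ha
      (by omega) hab (n := n) (by omega)
    refine ⟨w, hw.trans ?_, by simpa [hFn] using hwe⟩
    gcongr
    exact_mod_cast (by omega : N + 1 ≤ T)
  choose w hw hwe using hseq
  have hlim : Tendsto w atTop (nhds 0) := by
    refine squeeze_zero_norm hw ?_
    have := tendsto_one_div_add_atTop_nhds_zero_nat (𝕜 := ℝ)
    simpa [div_eq_mul_inv] using this.const_mul (144 * ((n : ℝ) + 2) ^ 2)
  have hlim2 := ((Complex.continuous_exp.tendsto 0).comp hlim).const_mul (ω (n + 1) ^ 2)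
  rw [Complex.exp_zero, mul_one] at hlim2
  -- The left side does not depend on N, so it equals the limit ω(n+1)².
  refine tendsto_nhds_unique (tendsto_const_nhds.congr fun N => ?_) hlim2
  exact hwe N
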